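/- Consider a receiver with $N$ equally spaced ports on a line segment of length $W\lambda$ ($W>0$, $\lambda>0$ the wavelength), and let $\kappa\ge 0$ be the Rician factor, $A=\sqrt{\kappa/(\kappa+1)}$, $\sigma=\sqrt{1/(\kappa+1)}$. Put $l_{n}=\frac{n-1}{N-1}W\lambda$ and $\rho_n=J_0(2\pi l_{n}/\lambda)$ for $2\le n\le N$, where $J_0$ is the Bessel function of the first kind of order $0$. Let $x_0,y_0,x_2,y_2,x_3,y_3,\dots$ be independent real $\mathcal N(0,\tfrac12)$ random variables and let the channel coefficients be $$h_1=\sigma x_0+j\sigma y_0+A,\qquad h_n=\sigma\Big(\sqrt{1-\rho_n^2}\,x_n+\rho_n x_0\Big)+j\sigma\Big(\sqrt{1-\rho_n^2}\,y_n+\rho_n y_0\Big)+A\quad(2\le n\le N).$$ For a threshold $\gamma_{th}>0$ the outage probability is $$p_{out}(N)=\mathbb P\left(\frac{\max_{1\le n\le N}|h_n|^2}{A^2+\sigma^2}<\gamma_{th}\right).$$ **Proposition.** Fix $W>0$, $\lambda>0$, $\kappa\ge0$ and $\gamma_{th}>0$. Then $|\rho_n|\ne 1$ for all $2\le n\le N$,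 $p_{out}(N)>0$ for all $N\ge1$, and the high-$N$ slope is infinite: $$S_\infty=-\lim_{N\to\infty}\frac{\log p_{out}(N)}{\log N}=+\infty .$$ Consequently the outage probability can be made arbitrarily small by increasing the number of ports: for every $\varepsilon>0$ there is $N_0$ such that $p_{out}(N)<\varepsilon$ for all $N\ge N_0$. -/

import Mathlib

open MeasureTheory ProbabilityTheory Filter Topology
open scoped NNReal

noncomputable section

/-- The Bessel function of the first kind of order zero, by Bessel's integral
`J₀(x) = (1/π) ∫₀^π cos(x sin θ) dθ`. -/
def besselJ0 (x : ℝ) : ℝ :=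
  (1 / Real.pi) * ∫ θ in (0 : ℝ)..Real.pi, Real.cos (x * Real.sin θ)

/-- Displacement from port 1 of the `n`-th of `N` equally spaced ports on a line of length `W * lam`,
where `lam` is the carrier wavelength. -/
def portDisplacement (W lam : ℝ) (N n : ℕ) : ℝ :=
  (((n : ℝ) - 1) / ((N : ℝ) - 1)) * (W * lam)

/-- Spatial correlation factor `ρ_n` between port 1 and port `n` (of `N` ports). -/
def portCorrelation (W lam : ℝ) (N n : ℕ) : ℝ :=
  besselJ0 (2 * Real.pi * (portDisplacement W lam N n / lam))

/-- Amplitude `A` of the line-of-sight component for Rician factor `κ`: `A² = κ / (κ + 1)`. -/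
def losAmplitude (κ : ℝ) : ℝ := Real.sqrt (κ / (κ + 1))

/-- Scale `σ` of the scattered component for Rician factor `κ`: `σ² = 1 / (κ + 1)`. -/
def scatterScale (κ : ℝ) : ℝ := Real.sqrt (1 / (κ + 1))

/-- The complex channel coefficient `h_n`, `1 ≤ n ≤ N`, of the Rician fluid antenna with `N` ports,
driven by the real random variables `x_0, x_n, y_0, y_n`. -/
def channel {Ω : Type*} (x y : ℕ → Ω → ℝ) (W lam κ : ℝ) (N n : ℕ) (ω : Ω) : ℂ :=
  let σ := scatterScale κ
  let A := losAmplitude κ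
  let ρ := portCorrelation W lam N n
  if n = 1 then
    ((σ * x 0 ω : ℝ) : ℂ) + Complex.I * ((σ * y 0 ω : ℝ) : ℂ) + (A : ℂ)
  else
    ((σ * (Real.sqrt (1 - ρ ^ 2) * x n ω + ρ * x 0 ω) : ℝ) : ℂ)
      + Complex.I * ((σ * (Real.sqrt (1 - ρ ^ 2) * y n ω + ρ * y 0 ω) : ℝ) : ℂ) + (A : ℂ)

/-- The gain `|h_FAS| = max {|h_1|, …, |h_N|}` of the strongest port. -/
def fasGain {Ω : Type*} (x y : ℕ → Ω → ℝ) (W lam κ : ℝ) (N : ℕ) (ω : Ω) : ℝ :=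
  ((Finset.Icc 1 N).sup fun n => ‖channel x y W lam κ N n ω‖₊ : ℝ≥0)

/-- The outage probability: the probability that the normalized signal-to-noise ratio
`|h_FAS|² / (A² + σ²)` is below the threshold `γ`. -/
def outageProb {Ω : Type*} [MeasurableSpace Ω] (P : Measure Ω) (x y : ℕ → Ω → ℝ)
    (W lam κ γ : ℝ) (N : ℕ) : ℝ :=
  P.real {ω | fasGain x y W lam κ N ω ^ 2 / (losAmplitude κ ^ 2 + scatterScale κ ^ 2) < γ}

end

/-! For ports on the far half of the line the argument of `besselJ0` lies in `[πW, 2πW]`, a compact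
set avoiding `0`, so their correlations with port 1 are at most some `M < 1` in absolute value.
Freeze `x 0`: the real parts of these channels are then independent Gaussians with standard
deviation bounded below, and outage forces each into `(-√γ, √γ)`, with probability at most some `c <
1` whatever the mean. Hence outage has probability at most `c ^ (N - N / 2)`
(`exists_outageProb_le_pow`), which beats every power of `N`. Positivity (`outageProb_pos`) holds
because the Gaussians charge a neighbourhood of a point where all channels vanish. -/

/-! ### Bessel function and port correlations -/

lemma continuous_besselJ0 : Continuous besselJ0 := by
  unfold besselJ0
  fun_prop

lemma abs_besselJ0_lt_one {x : ℝ} (hx : x ≠ 0) : |besselJ0 x| < 1 := by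
  have hpi := Real.pi_pos
  have habs : 0 < |x| := abs_pos.2 hx
  have key : (∫ θ in (0 : ℝ)..Real.pi, |Real.cos (x * Real.sin θ)|) <
      ∫ _ in (0 : ℝ)..Real.pi, (1 : ℝ) := by
    refine intervalIntegral.integral_lt_integral_of_continuousOn_of_le_of_exists_lt hpi
      (by fun_prop) (by fun_prop) (fun θ _ => Real.abs_cos_le_one _) ?_
    -- At `sin θ = s` the cosine's argument has size `|x| * s` in `(0, 1]`, where the cosine is
    -- positive and strictly below `1`.
    set s : ℝ := min 1 |x|⁻¹ with hs
    have hs0 : 0 < s := lt_min one_pos (inv_pos.2 habs)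
    have hs1 : s ≤ 1 := min_le_left _ _
    have hxs : |x| * s ≤ 1 :=
      (mul_le_mul_of_nonneg_left (min_le_right 1 |x|⁻¹) habs.le).trans_eq (mul_inv_cancel₀ habs.ne')
    refine ⟨Real.arcsin s, ⟨Real.arcsin_nonneg.2 hs0.le,
      (Real.arcsin_le_pi_div_two s).trans (by linarith)⟩, ?_⟩
    rw [Real.sin_arcsin (by linarith) hs1, ← Real.cos_abs, abs_mul, abs_of_pos hs0]
    have hpos : 0 < |x| * s := mul_pos habs hs0
    have hpi3 := Real.pi_gt_three
    rw [abs_of_pos (Real.cos_pos_of_mem_Ioo ⟨by linarith, by linarith⟩), ← Real.cos_zero]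
    exact Real.cos_lt_cos_of_nonneg_of_le_pi le_rfl (by linarith) hpos
  have hle : |∫ θ in (0 : ℝ)..Real.pi, Real.cos (x * Real.sin θ)| ≤
      ∫ θ in (0 : ℝ)..Real.pi, |Real.cos (x * Real.sin θ)| :=
    intervalIntegral.abs_integral_le_integral_abs hpi.le
  rw [intervalIntegral.integral_const, smul_eq_mul, mul_one, sub_zero] at key
  rw [besselJ0, abs_mul, abs_of_pos (by positivity), one_div, inv_mul_lt_iff₀ hpi, mul_one]
  exact hle.trans_lt key

lemma portCorrelation_eq {W lam : ℝ} (hlam : lam ≠ 0) (N n : ℕ) :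
    portCorrelation W lam N n = besselJ0 (2 * Real.pi * ((((n : ℝ) - 1) / ((N : ℝ) - 1)) * W)) := by
  rw [portCorrelation, portDisplacement]
  congr 2
  field_simp

lemma abs_portCorrelation_lt_one {W lam : ℝ} (hW : 0 < W) (hlam : 0 < lam) {N n : ℕ}
    (hn : 2 ≤ n) (hnN : n ≤ N) : |portCorrelation W lam N n| < 1 := by
  rw [portCorrelation_eq hlam.ne']
  have h1 : (2 : ℝ) ≤ n := by exact_mod_cast hn
  have h2 : (n : ℝ) ≤ N := by exact_mod_cast hnN
  have h3 : 0 < (n : ℝ) - 1 := by linarith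
  have h4 : 0 < (N : ℝ) - 1 := by linarith
  exact abs_besselJ0_lt_one (by positivity)

/-- The correlation with the first port stays uniformly away from `±1` on the far half of the
line. -/
lemma exists_forall_abs_portCorrelation_le {W lam : ℝ} (hW : 0 < W) (hlam : 0 < lam) :
    ∃ M : ℝ, 0 ≤ M ∧ M < 1 ∧ ∀ N n : ℕ, 2 ≤ n → N < 2 * n → n ≤ N →
      |portCorrelation W lam N n| ≤ M := by
  have hpi := Real.pi_pos
  have hne : (Set.Icc (Real.pi * W) (2 * Real.pi * W)).Nonempty :=
    Set.nonempty_Icc.2 (by nlinarith [mul_pos hpi hW])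
  obtain ⟨x₀, hx₀, hmax⟩ := isCompact_Icc.exists_isMaxOn hne
    (f := fun x => |besselJ0 x|) continuous_besselJ0.abs.continuousOn
  refine ⟨|besselJ0 x₀|, abs_nonneg _,
    abs_besselJ0_lt_one (lt_of_lt_of_le (by positivity) hx₀.1).ne', ?_⟩
  intro N n hn hN hnN
  rw [portCorrelation_eq hlam.ne']
  apply hmax
  have h1 : (2 : ℝ) ≤ n := by exact_mod_cast hn
  have h2 : (n : ℝ) ≤ N := by exact_mod_cast hnN
  have h3 : (N : ℝ) + 1 ≤ 2 * n := by exact_mod_cast hN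
  have h4 : 0 < (N : ℝ) - 1 := by linarith
  -- `N < 2 * n` means `N + 1 ≤ 2 * n`, exactly `N - 1 ≤ 2 * (n - 1)`.
  have hlow : 1 / 2 ≤ ((n : ℝ) - 1) / ((N : ℝ) - 1) := by
    rw [div_le_div_iff₀ two_pos h4]; linarith
  have hup : ((n : ℝ) - 1) / ((N : ℝ) - 1) ≤ 1 := (div_le_one h4).2 (by linarith)
  have hpW : 0 < Real.pi * W := mul_pos hpi hW
  constructor <;> nlinarith

lemma scatterScale_pos {κ : ℝ} (hκ : 0 ≤ κ) : 0 < scatterScale κ :=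
  Real.sqrt_pos.2 (by positivity)

lemma losAmplitude_sq_add_scatterScale_sq {κ : ℝ} (hκ : 0 ≤ κ) :
    losAmplitude κ ^ 2 + scatterScale κ ^ 2 = 1 := by
  rw [losAmplitude, scatterScale, Real.sq_sqrt (by positivity), Real.sq_sqrt (by positivity)]
  field_simp

/-! ### Outage in terms of channel coordinates -/

section Channel

variable {Ω : Type*} (x y : ℕ → Ω → ℝ) (W lam : ℝ) {κ γ : ℝ} (N : ℕ) (ω : Ω)

lemma outage_iff (hκ : 0 ≤ κ) (hγ : 0 < γ) :
    fasGain x y W lam κ N ω ^ 2 / (losAmplitude κ ^ 2 + scatterScale κ ^ 2) < γ ↔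
      ∀ n ∈ Finset.Icc 1 N, ‖channel x y W lam κ N n ω‖ < √γ := by
  rw [losAmplitude_sq_add_scatterScale_sq hκ, div_one,
    ← Real.lt_sqrt (by unfold fasGain; positivity)]
  have hr : 0 < √γ := Real.sqrt_pos.2 hγ
  have h : (⊥ : ℝ≥0) < ⟨√γ, hr.le⟩ := by
    rw [bot_eq_zero]; exact hr
  exact Finset.sup_lt_iff h

lemma channel_one_re :
    (channel x y W lam κ N 1 ω).re = scatterScale κ * x 0 ω + losAmplitude κ := by
  simp [channel]

lemma channel_one_im : (channel x y W lam κ N 1 ω).im = scatterScale κ * y 0 ω := by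
  simp [channel]

lemma channel_re {n : ℕ} (hn : n ≠ 1) :
    (channel x y W lam κ N n ω).re =
      scatterScale κ * (√(1 - portCorrelation W lam N n ^ 2) * x n ω
        + portCorrelation W lam N n * x 0 ω) + losAmplitude κ := by
  simp only [channel, hn, if_false, Complex.add_re, Complex.ofReal_re, Complex.re_mul_ofReal,
    Complex.I_re, zero_mul, add_zero]

lemma channel_im {n : ℕ} (hn : n ≠ 1) :
    (channel x y W lam κ N n ω).im =
      scatterScale κ * (√(1 - portCorrelation W lam N n ^ 2) * y n ω
        + portCorrelation W lam N n * y 0 ω) := by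
  simp only [channel, hn, if_false, Complex.add_im, Complex.ofReal_im, Complex.im_mul_ofReal,
    Complex.I_im, one_mul, zero_add, add_zero]

end Channel

/-! ### Gaussian estimate and conditioning -/

lemma isOpenPosMeasure_gaussianReal (μ : ℝ) {v : ℝ≥0} (hv : v ≠ 0) :
    (gaussianReal μ v).IsOpenPosMeasure :=
  (gaussianReal_absolutelyContinuous' μ hv).isOpenPosMeasure

/-- A nondegenerate affine image of a Gaussian variable misses a bounded interval with a probability
that is bounded below, uniformly in the shift and in large scales. -/
lemma exists_gaussianReal_abs_affine_lt_le {v : ℝ≥0} (hv : v ≠ 0) {s₀ : ℝ} (hs₀ : 0 < s₀)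
    {r : ℝ} (hr : 0 < r) :
    ∃ c : ℝ≥0, 0 < c ∧ c < 1 ∧ ∀ s, s₀ ≤ s → ∀ m : ℝ,
      gaussianReal 0 v {z | |s * z + m| < r} ≤ c := by
  set μ := gaussianReal 0 v with hμ
  have : μ.IsOpenPosMeasure := isOpenPosMeasure_gaussianReal 0 hv
  have hlt : ∀ s : Set ℝ, MeasurableSet s → (interior sᶜ).Nonempty → μ s < 1 := by
    intro s hs hne
    refine prob_le_one.lt_of_ne fun h => ?_
    exact (Measure.measure_pos_of_nonempty_interior μ hne).ne' ((prob_compl_eq_zero_iff hs).2 h)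
  -- According to the sign of `m`, the event lies in one of two fixed half-lines, neither of full
  -- measure; this gives uniformity in `m`.
  set t := r / s₀ with ht
  have h1 : μ (Set.Iio t) < 1 := hlt _ measurableSet_Iio (by simp [Set.nonempty_Ioi])
  have h2 : μ (Set.Ioi (-t)) < 1 := hlt _ measurableSet_Ioi (by simp [Set.nonempty_Iio])
  -- The `1 / 2` only serves to make `c` positive.
  refine ⟨max (1 / 2) (max (μ (Set.Iio t)).toNNReal (μ (Set.Ioi (-t))).toNNReal),
    lt_max_of_lt_left (by norm_num), max_lt (NNReal.half_lt_self one_ne_zero) (max_lt ?_ ?_), ?_⟩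
  · rw [← ENNReal.coe_lt_coe, ENNReal.coe_toNNReal (measure_ne_top _ _)]; simpa using h1
  · rw [← ENNReal.coe_lt_coe, ENNReal.coe_toNNReal (measure_ne_top _ _)]; simpa using h2
  intro s hs m
  have hts : t * s₀ = r := div_mul_cancel₀ _ hs₀.ne'
  have ht0 : 0 < t := div_pos hr hs₀
  rcases le_total 0 m with hm | hm
  · have hsub : {z | |s * z + m| < r} ⊆ Set.Iio t := by
      intro z hz
      by_contra hzt
      rw [Set.mem_Iio, not_lt] at hzt
      have hz' : |s * z + m| < r := hz
      have := (abs_lt.1 hz').2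
      nlinarith [mul_le_mul hs hzt ht0.le (hs₀.le.trans hs)]
    refine (measure_mono hsub).trans ?_
    rw [← ENNReal.coe_toNNReal (measure_ne_top μ (Set.Iio t)), ENNReal.coe_le_coe]
    exact le_max_of_le_right (le_max_left _ _)
  · have hsub : {z | |s * z + m| < r} ⊆ Set.Ioi (-t) := by
      intro z hz
      by_contra hzt
      rw [Set.mem_Ioi, not_lt] at hzt
      have hz' : |s * z + m| < r := hz
      have := (abs_lt.1 hz').1
      nlinarith [mul_le_mul hs (le_neg.1 hzt) ht0.le (hs₀.le.trans hs)]
    refine (measure_mono hsub).trans ?_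
    rw [← ENNReal.coe_toNNReal (measure_ne_top μ (Set.Ioi (-t))), ENNReal.coe_le_coe]
    exact le_max_of_le_right (le_max_right _ _)

/-- If, for every value of `X i₀`, each of the events that constrain `X i` for `i ∈ S` has probability
at most `c`, then they occur jointly with probability at most `c ^ #S`. -/
lemma ProbabilityTheory.iIndepFun.measure_forall_prodMk_mem_le {Ω ι α : Type*}
    [MeasurableSpace Ω] [MeasurableSpace α] {P : Measure Ω} [IsProbabilityMeasure P]
    {X : ι → Ω → α} (hX : ∀ i, AEMeasurable (X i) P) (hindep : iIndepFun X P)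
    {i₀ : ι} {S : Finset ι} (hS : i₀ ∉ S) {B : ι → Set (α × α)} (hB : ∀ i, MeasurableSet (B i))
    {c : ENNReal} (hc : ∀ i ∈ S, ∀ a, P.map (X i) {b | (a, b) ∈ B i} ≤ c) :
    P {ω | ∀ i ∈ S, (X i₀ ω, X i ω) ∈ B i} ≤ c ^ S.card := by
  have hpair : IndepFun (X i₀) (fun ω (i : S) => X i ω) P :=
    (hindep.indepFun_finset₀ {i₀} S (Finset.disjoint_singleton_left.2 hS) hX).comp
      (φ := fun z : ({i₀} : Finset ι) → α => z ⟨i₀, Finset.mem_singleton_self i₀⟩)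
      (ψ := fun z => z) (measurable_pi_apply (⟨i₀, Finset.mem_singleton_self i₀⟩ : ({i₀} : Finset ι)))
      measurable_id
  have hZ : AEMeasurable (fun ω (i : S) => X i ω) P := aemeasurable_pi_lambda _ fun i => hX i
  set E : Set (α × (S → α)) := {p | ∀ i : S, (p.1, p.2 i) ∈ B i} with hE_def
  have hE : MeasurableSet E := by
    rw [hE_def, Set.ofPred_forall]
    exact MeasurableSet.iInter fun i =>
      (measurable_fst.prodMk ((measurable_pi_apply i).comp measurable_snd)) (hB i)
  have hset : {ω | ∀ i ∈ S, (X i₀ ω, X i ω) ∈ B i} =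
      (fun ω => (X i₀ ω, fun i : S => X i ω)) ⁻¹' E := by
    ext ω
    simp [hE_def]
  have : IsProbabilityMeasure (P.map (X i₀)) := Measure.isProbabilityMeasure_map (hX i₀)
  have : IsProbabilityMeasure (P.map fun ω (i : S) => X i ω) := Measure.isProbabilityMeasure_map hZ
  rw [hset, ← Measure.map_apply_of_aemeasurable ((hX i₀).prodMk hZ) hE,
    (indepFun_iff_map_prod_eq_prod_map_map (hX i₀) hZ).1 hpair, Measure.prod_apply hE]
  -- By Fubini it suffices to freeze `X i₀ = a`; the constraints then involve independent variables
  -- and the probability factorises.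
  have hsection : ∀ a, P.map (fun ω (i : S) => X i ω) (Prod.mk a ⁻¹' E) ≤ c ^ S.card := by
    intro a
    have hBa : ∀ i, MeasurableSet {b | (a, b) ∈ B i} := fun i => measurable_prodMk_left (hB i)
    rw [Measure.map_apply_of_aemeasurable hZ (measurable_prodMk_left hE)]
    have heq : (fun ω (i : S) => X i ω) ⁻¹' (Prod.mk a ⁻¹' E) =
        ⋂ i ∈ S, X i ⁻¹' {b | (a, b) ∈ B i} := by
      ext ω
      simp [hE_def]
    rw [heq, hindep.measure_inter_preimage_eq_mul S fun i _ => hBa i]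
    refine Finset.prod_le_pow_card _ _ _ fun i hi => ?_
    rw [← Measure.map_apply_of_aemeasurable (hX i) (hBa i)]
    exact hc i hi a
  calc ∫⁻ a, P.map (fun ω (i : S) => X i ω) (Prod.mk a ⁻¹' E) ∂P.map (X i₀)
      ≤ ∫⁻ _, c ^ S.card ∂P.map (X i₀) := lintegral_mono hsection
    _ = c ^ S.card := by simp

/-! ### Exponential upper bound and positivity -/

section Outage

variable {Ω : Type*} [MeasurableSpace Ω] {P : Measure Ω} [IsProbabilityMeasure P]
  {x y : ℕ → Ω → ℝ} {W lam κ γ : ℝ}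

/-- The outage probability decays exponentially in the number of ports. -/
lemma exists_outageProb_le_pow (y : ℕ → Ω → ℝ)
    (hx : ∀ n, HasLaw (x n) (gaussianReal 0 (1 / 2)) P) (hindep : iIndepFun x P)
    (hW : 0 < W) (hlam : 0 < lam) (hκ : 0 ≤ κ) (hγ : 0 < γ) :
    ∃ c : ℝ, 0 < c ∧ c < 1 ∧ ∀ N : ℕ, 2 ≤ N → outageProb P x y W lam κ γ N ≤ c ^ (N - N / 2) := by
  obtain ⟨M, hM0, hM1, hM⟩ := exists_forall_abs_portCorrelation_le hW hlam
  have hσ := scatterScale_pos hκ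
  set σ := scatterScale κ with hσ_def
  have hs₀ : 0 < σ * √(1 - M ^ 2) := mul_pos hσ (Real.sqrt_pos.2 (by nlinarith))
  obtain ⟨c, hc0, hc1, hc⟩ := exists_gaussianReal_abs_affine_lt_le (v := 1 / 2) (by simp) hs₀
    (Real.sqrt_pos.2 hγ)
  refine ⟨c, by exact_mod_cast hc0, by exact_mod_cast hc1, fun N hN => ?_⟩
  set ρ := portCorrelation W lam N with hρ_def
  -- As `2 ≤ N`, these indices avoid both `0` and the special port `1`, and satisfy `N < 2 * n`.
  set S := Finset.Icc (N / 2 + 1) N with hS_def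
  set B : ℕ → Set (ℝ × ℝ) := fun n =>
    {p | |σ * √(1 - ρ n ^ 2) * p.2 + (σ * ρ n * p.1 + losAmplitude κ)| < √γ} with hB_def
  have hB : ∀ n, MeasurableSet (B n) := fun n =>
    measurableSet_lt (by fun_prop) measurable_const
  have hcS : ∀ n ∈ S, ∀ a, P.map (x n) {b | (a, b) ∈ B n} ≤ c := by
    intro n hn a
    rw [(hx n).map_eq]
    refine hc (σ * √(1 - ρ n ^ 2)) ?_ (σ * ρ n * a + losAmplitude κ)
    rw [hS_def, Finset.mem_Icc] at hn
    have := hM N n (by omega) (by omega) hn.2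
    refine mul_le_mul_of_nonneg_left (Real.sqrt_le_sqrt ?_) hσ.le
    have := sq_le_sq' (neg_le_of_abs_le this) (le_of_abs_le this)
    linarith
  have hbound := hindep.measure_forall_prodMk_mem_le (fun n => (hx n).aemeasurable)
    (i₀ := 0) (S := S) (by simp [hS_def]) hB hcS
  have hsub : {ω | fasGain x y W lam κ N ω ^ 2 / (losAmplitude κ ^ 2 + scatterScale κ ^ 2) < γ} ⊆
      {ω | ∀ n ∈ S, (x 0 ω, x n ω) ∈ B n} := by
    intro ω hω n hn
    have hω' := (outage_iff x y W lam N ω hκ hγ).1 hω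
    rw [hS_def, Finset.mem_Icc] at hn
    have h := (Complex.abs_re_le_norm _).trans_lt (hω' n (Finset.mem_Icc.2 ⟨by omega, hn.2⟩))
    rw [channel_re x y W lam N ω (by omega), ← hσ_def, ← hρ_def] at h
    change |σ * √(1 - ρ n ^ 2) * x n ω + (σ * ρ n * x 0 ω + losAmplitude κ)| < √γ
    rw [show ∀ s u v w A : ℝ, σ * s * v + (σ * u * w + A) = σ * (s * v + u * w) + A by
      intros; ring]
    exact h
  have hcard : S.card = N - N / 2 := by
    rw [hS_def, Nat.card_Icc]; omega
  have hle := (measure_mono hsub).trans hbound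
  rw [hcard] at hle
  have := ENNReal.toReal_mono (ENNReal.pow_ne_top ENNReal.coe_ne_top) hle
  simpa [outageProb, Measure.real] using this

lemma outageProb_pos
    (hx : ∀ n, HasLaw (x n) (gaussianReal 0 (1 / 2)) P)
    (hy : ∀ n, HasLaw (y n) (gaussianReal 0 (1 / 2)) P)
    (hindep : iIndepFun (Sum.elim x y) P)
    (hW : 0 < W) (hlam : 0 < lam) (hκ : 0 ≤ κ) (hγ : 0 < γ) (N : ℕ) :
    0 < outageProb P x y W lam κ γ N := by
  have hσ := scatterScale_pos hκ
  have hσ1 : scatterScale κ ≤ 1 := by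
    have := losAmplitude_sq_add_scatterScale_sq hκ
    nlinarith [sq_nonneg (losAmplitude κ)]
  set σ := scatterScale κ with hσ_def
  set A := losAmplitude κ with hA_def
  set ρ := portCorrelation W lam N with hρ_def
  have hr : 0 < √γ := Real.sqrt_pos.2 hγ
  set δ := √γ / 4 with hδ_def
  have hδ : 0 < δ := by positivity
  -- With `x 0 = -A / σ` and all `y n = 0`, these values cancel the line-of-sight term `A` in every
  -- port. The value at `n = 1` is irrelevant: port 1 depends only on index `0`.
  set a : ℕ → ℝ := fun n => if n = 0 then -(A / σ) else
    -((A / σ) * (1 - ρ n)) / √(1 - ρ n ^ 2) with ha_def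
  set ctr : ℕ ⊕ ℕ → ℝ := Sum.elim a 0 with hctr_def
  have hlaw : ∀ i, HasLaw (Sum.elim x y i) (gaussianReal 0 (1 / 2)) P := by
    rintro (n | n)
    · exact hx n
    · exact hy n
  set T : Finset (ℕ ⊕ ℕ) := (Finset.range (N + 1)).disjSum (Finset.range (N + 1)) with hT_def
  have hpos : 0 < P (⋂ i ∈ T, Sum.elim x y i ⁻¹' Metric.ball (ctr i) δ) := by
    rw [hindep.measure_inter_preimage_eq_mul T fun i _ => measurableSet_ball]
    refine pos_of_ne_zero (Finset.prod_ne_zero_iff.2 fun i _ => ?_)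
    have : (gaussianReal 0 (1 / 2)).IsOpenPosMeasure :=
      isOpenPosMeasure_gaussianReal 0 (by simp)
    rw [← Measure.map_apply_of_aemeasurable (hlaw i).aemeasurable measurableSet_ball,
      (hlaw i).map_eq]
    exact (Metric.measure_ball_pos _ _ hδ).ne'
  refine ENNReal.toReal_pos (hpos.trans_le (measure_mono ?_)).ne' (measure_ne_top _ _)
  intro ω hω
  rw [Set.mem_iInter₂] at hω
  have hωx : ∀ n ≤ N, |x n ω - a n| < δ := fun n hn => by
    simpa [Real.dist_eq, hctr_def] using hω (Sum.inl n) (by simp [hT_def]; omega)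
  have hωy : ∀ n ≤ N, |y n ω| < δ := fun n hn => by
    simpa [Real.dist_eq, hctr_def] using hω (Sum.inr n) (by simp [hT_def]; omega)
  refine (outage_iff x y W lam N ω hκ hγ).2 fun n hn => ?_
  rw [Finset.mem_Icc] at hn
  have hx0 : |x 0 ω + A / σ| < δ := by simpa [ha_def] using hωx 0 (Nat.zero_le _)
  have hy0 := hωy 0 (Nat.zero_le _)
  have hcomb : ∀ s t u v : ℝ, |s| ≤ 1 → |t| ≤ 1 → |u| < δ → |v| < δ →
      |σ * (s * u + t * v)| < 2 * δ := by
    intro s t u v hs ht hu hv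
    calc |σ * (s * u + t * v)| = σ * |s * u + t * v| := by rw [abs_mul, abs_of_pos hσ]
      _ ≤ 1 * |s * u + t * v| := mul_le_mul_of_nonneg_right hσ1 (abs_nonneg _)
      _ ≤ |s| * |u| + |t| * |v| := by
        rw [one_mul, ← abs_mul, ← abs_mul]; exact abs_add_le _ _
      _ ≤ 1 * |u| + 1 * |v| := by gcongr
      _ < 2 * δ := by linarith
  have hAσ : σ * (A / σ) = A := mul_div_cancel₀ A hσ.ne'
  suffices h : |(channel x y W lam κ N n ω).re| < 2 * δ ∧
      |(channel x y W lam κ N n ω).im| < 2 * δ by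
    refine (Complex.norm_le_abs_re_add_abs_im _).trans_lt ?_
    linarith [h.1, h.2]
  rcases eq_or_ne n 1 with rfl | hn1
  · rw [channel_one_re, channel_one_im]
    constructor
    · have := hcomb 1 0 _ 0 (by simp) (by simp) hx0 (by simpa using hδ)
      convert this using 2
      linear_combination -hAσ
    · have := hcomb 1 0 _ 0 (by simp) (by simp) hy0 (by simpa using hδ)
      convert this using 2
      ring
  · have hρ : |ρ n| < 1 := abs_portCorrelation_lt_one hW hlam (by omega) hn.2
    have hρ2 : ρ n ^ 2 < 1 := by rwa [sq_lt_one_iff_abs_lt_one]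
    have hs : 0 < √(1 - ρ n ^ 2) := Real.sqrt_pos.2 (by linarith)
    have hs1 : |√(1 - ρ n ^ 2)| ≤ 1 := by
      rw [abs_of_pos hs, Real.sqrt_le_one]
      linarith [sq_nonneg (ρ n)]
    rw [channel_re x y W lam N ω hn1, channel_im x y W lam N ω hn1]
    constructor
    · have := hcomb _ (ρ n) _ _ hs1 hρ.le (hωx n hn.2) hx0
      convert this using 2
      have han : √(1 - ρ n ^ 2) * a n = -((A / σ) * (1 - ρ n)) := by
        simp only [ha_def, if_neg (show n ≠ 0 by omega)]
        exact mul_div_cancel₀ _ hs.ne'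
      linear_combination σ * han - hAσ
    · exact hcomb _ (ρ n) _ _ hs1 hρ.le (hωy n hn.2) hy0

end Outage

/-! ### Asymptotics from the exponential bound -/

/-- Since `-log p ≥ (N / 2) * (-log c)` and `log N ≤ 2 * √N`, the quotient is at least `(-log c / 4)
* √N`. -/
lemma tendsto_neg_log_div_log_of_le_pow {p : ℕ → ℝ} {c : ℝ} (hc0 : 0 < c) (hc1 : c < 1)
    (hp : ∀ N, 0 < p N) (hpc : ∀ N, 2 ≤ N → p N ≤ c ^ (N - N / 2)) :
    Tendsto (fun N : ℕ => -(Real.log (p N) / Real.log N)) atTop atTop := by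
  have hL : 0 < -Real.log c := neg_pos.2 (Real.log_neg hc0 hc1)
  have hsqrt : Tendsto (fun N : ℕ => (-Real.log c / 4) * √(N : ℝ)) atTop atTop :=
    (Real.tendsto_sqrt_atTop.comp tendsto_natCast_atTop_atTop).const_mul_atTop (by positivity)
  refine tendsto_atTop_mono' _ ?_ hsqrt
  filter_upwards [eventually_ge_atTop 2] with N hN
  have hN' : (2 : ℝ) ≤ N := by exact_mod_cast hN
  have hlogN : 0 < Real.log N := Real.log_pos (by linarith)
  have hs : 0 < √(N : ℝ) := Real.sqrt_pos.2 (by linarith)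
  have hlog_le : Real.log N ≤ 2 * √(N : ℝ) := by
    have h1 := Real.log_le_sub_one_of_pos hs
    rw [Real.log_sqrt (by positivity)] at h1
    linarith
  have hhalf : (N : ℝ) / 2 ≤ ((N - N / 2 : ℕ) : ℝ) := by
    have : N ≤ 2 * (N - N / 2) := by omega
    have : (N : ℝ) ≤ 2 * ((N - N / 2 : ℕ) : ℝ) := by exact_mod_cast this
    linarith
  have hlogp : Real.log (p N) ≤ ((N - N / 2 : ℕ) : ℝ) * Real.log c := by
    rw [← Real.log_pow]
    exact Real.log_le_log (hp N) (hpc N hN)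
  rw [← neg_div, le_div_iff₀ hlogN]
  calc (-Real.log c / 4) * √(N : ℝ) * Real.log N
      ≤ (-Real.log c / 4) * √(N : ℝ) * (2 * √(N : ℝ)) := by gcongr
    _ = (N : ℝ) / 2 * -Real.log c := by
      linear_combination (-Real.log c / 2) * Real.mul_self_sqrt (Nat.cast_nonneg (α := ℝ) N)
    _ ≤ ((N - N / 2 : ℕ) : ℝ) * -Real.log c := by gcongr
    _ ≤ -Real.log (p N) := by linarith

lemma exists_forall_lt_of_le_pow {p : ℕ → ℝ} {c : ℝ} (hc0 : 0 < c) (hc1 : c < 1)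
    (hpc : ∀ N, 2 ≤ N → p N ≤ c ^ (N - N / 2)) {ε : ℝ} (hε : 0 < ε) :
    ∃ N₀ : ℕ, ∀ N : ℕ, N₀ ≤ N → p N < ε := by
  obtain ⟨k, hk⟩ := exists_pow_lt_of_lt_one hε hc1
  refine ⟨2 * k + 2, fun N hN => (hpc N (by omega)).trans_lt (lt_of_le_of_lt ?_ hk)⟩
  exact pow_le_pow_of_le_one hc0.le hc1.le (by omega)

/-- `x n, y n` are independent real Gaussians of mean `0` and variance `1/2`; the antenna has normalized
length `W`, the wavelength is `lam`, the Rician factor is `κ`, and the outage threshold is `γ`. -/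
theorem mainTheorem7 {Ω : Type*} [MeasurableSpace Ω] (P : Measure Ω) [IsProbabilityMeasure P]
    (x y : ℕ → Ω → ℝ)
    (hx : ∀ n, HasLaw (x n) (gaussianReal 0 (1 / 2)) P)
    (hy : ∀ n, HasLaw (y n) (gaussianReal 0 (1 / 2)) P)
    (hindep : iIndepFun (Sum.elim x y) P)
    (W lam κ γ : ℝ) (hW : 0 < W) (hlam : 0 < lam) (hκ : 0 ≤ κ) (hγ : 0 < γ) :
    (∀ N n : ℕ, 2 ≤ n → n ≤ N → |portCorrelation W lam N n| ≠ 1) ∧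
    (∀ N : ℕ, 1 ≤ N → 0 < outageProb P x y W lam κ γ N) ∧
    Tendsto (fun N : ℕ => -(Real.log (outageProb P x y W lam κ γ N) / Real.log (N : ℝ)))
      atTop atTop ∧
    (∀ ε : ℝ, 0 < ε → ∃ N₀ : ℕ, ∀ N : ℕ, N₀ ≤ N → outageProb P x y W lam κ γ N < ε) := by
  have hindepx : iIndepFun x P := hindep.precomp (g := Sum.inl) Sum.inl_injective
  obtain ⟨c, hc0, hc1, hc⟩ := exists_outageProb_le_pow y hx hindepx hW hlam hκ hγ
  have hpos := outageProb_pos hx hy hindep hW hlam hκ hγ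
  exact ⟨fun N n hn hnN => (abs_portCorrelation_lt_one hW hlam hn hnN).ne, fun N _ => hpos N,
    tendsto_neg_log_div_log_of_le_pow hc0 hc1 hpos hc,
    fun ε hε => exists_forall_lt_of_le_pow hc0 hc1 hc hε⟩
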